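/- Let $G$ be a locally compact (Hausdorff) group. Let $\mu$ denote a left Haar measure and $\nu$ a right Haar measure, and let $\Delta_G : G \to (\mathbb{R}_{>0}, \times)$ be the modular function, defined by $\mu(Ax) = \Delta_G(x)\,\mu(A)$. For an integer $n \ge 0$ and $(x,y) \in \mathbb{R}^2$ put $\|(x,y)\|_{1/n} = (|x|^{1/n} + |y|^{1/n})^n$ if $n \neq 0$ and $\|(x,y)\|_{1/n} = \max\{|x|,|y|\}$ if $n = 0$. We say that a locally compact group $G$, with left and right Haar measures $\mu$ and $\nu$, satisfies the Brunn--Minkowski inequality with exponent $n$, abbreviated $\mathrm{BM}(n)$, if $$\left\| \left( \frac{\nu(X)}{\nu(XY)}, \frac{\mu(Y)}{\mu(XY)} \right) \right\|_{1/n} \le 1 \qquad \text{for all compact } X, Y \subseteq G,$$ where $XY = \{xy : x \in X,\ y \in Y\}$ and $0/0$ is read as $0$. (This does not depend on the normalizations of $\mu$ and $\nu$.) Proposition. Let $n \ge 0$ be an integer. Suppose that $\Delta_G : G \to (\mathbb{R}_{>0}, \times)$ is a quotient map of topological groups, where $\mathbb{R}_{>0}$ has its usual topology, and that the group $\ker \Delta_G$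 (with the subspace topology) satisfies $\mathrm{BM}(n)$. Then $G$ satisfies $\mathrm{BM}(n+1)$. -/

import Mathlib

open scoped Pointwise

/-- A right Haar measure: right-translation-invariant, finite on compact sets, positive on nonempty
open sets, and regular. -/
class IsRightHaarMeasure {G : Type*} [Group G] [TopologicalSpace G] [MeasurableSpace G]
    (ν : MeasureTheory.Measure G) : Prop extends
    MeasureTheory.IsFiniteMeasureOnCompacts ν, ν.IsMulRightInvariant, ν.IsOpenPosMeasure,
    ν.Regular

/-- The modular function `Δ : G → (ℝ_{>0}, ×)`, characterized by `μ (A x) = Δ x * μ A` for a left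
Haar measure `μ`. Mathlib's `modularCharacterFun x` is the factor of `A ↦ μ (A x⁻¹)`, whence the
inverse. -/
noncomputable def modularFunction (G : Type*) [Group G] [TopologicalSpace G]
    [IsTopologicalGroup G] [LocallyCompactSpace G] : G →* {r : ℝ // 0 < r} where
  toFun x := ⟨(MeasureTheory.Measure.modularCharacterFun x⁻¹ : ℝ),
    NNReal.coe_pos.2 (MeasureTheory.Measure.modularCharacterFun_pos x⁻¹)⟩
  map_one' := by
    ext
    simp [MeasureTheory.Measure.modularCharacterFun_map_one]
  map_mul' x y := by
    ext
    simp [MeasureTheory.Measure.modularCharacterFun_map_mul, mul_comm]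

/-- `‖(x, y)‖_{1/n}`, which is `(|x|^{1/n} + |y|^{1/n})^n` for `n ≠ 0` and `max |x| |y|` for
`n = 0`. -/
noncomputable def bmNorm (n : ℕ) (x y : ℝ) : ℝ :=
  if n = 0 then max |x| |y| else (|x| ^ (1 / (n : ℝ)) + |y| ^ (1 / (n : ℝ))) ^ n

/-- The Brunn--Minkowski inequality with exponent `n`, for left Haar measures `μ` and right Haar
measures `ν` on `G`. Both quotients are independent of the normalizations. If the denominators
vanish then so do the numerators, and the quotients are read as `0`. -/
def SatisfiesBM (G : Type*) [Group G] [TopologicalSpace G] [MeasurableSpace G] (n : ℕ) : Prop :=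
  ∀ μ ν : MeasureTheory.Measure G, μ.IsHaarMeasure → μ.Regular → IsRightHaarMeasure ν →
    ∀ X Y : Set G, IsCompact X → IsCompact Y →
      bmNorm n (ν.real X / ν.real (X * Y)) (μ.real Y / μ.real (X * Y)) ≤ 1

open MeasureTheory

/-! Through `exp`, the modular function makes `G` an extension of `ℝ` by `N = ker Δ`, so a Haar
integral on `G` is an integral over `ℝ` of integrals over the cosets of `N`. For each `t ∈ [0, 1]`
it suffices that `ν X ≤ t ^ (n + 1) * ν (XY)` or `μ Y ≤ (1 - t) ^ (n + 1) * μ (XY)`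
(`bmNorm_succ_le_one`).

Let `F` (right measure) and `Q` (left measure) be the fibre measures of `X` and `Y` as functions on
`ℝ`, with maxima `α` and `β`, and let `KR`, `KL` be the right and left fibre measures of `XY`. The
inequality in `N`, linearised by Bernoulli (`one_le_of_bmNorm_le_one`, `SatisfiesBM.one_le_fibre`),
bounds `min (F x / α) (Q y / β)` by `t ^ (n + 1) / α * KR (x + y) + (1 - t) ^ (n + 1) / β * KL (x +
y)`. Brunn–Minkowski on `ℝ`, applied to superlevel sets (`integral_add_integral_le_of_min_le`),
integrates this to a bound on `∫ F / α + ∫ Q / β`, which forces one of the two alternatives.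
Continuous functions of compact support stand in for indicators, and regularity of the measures
returns to sets. -/

/-! ### Brunn–Minkowski on the line, for sets and for functions -/

/-- With `a = max K` and `b = min L`, the translates `K + b` and `a + L` lie in `K + L` and meet
only at `a + b`. -/
theorem IsCompact.volume_add_volume_le {K L : Set ℝ} (hK : IsCompact K) (hL : IsCompact L)
    (hK0 : K.Nonempty) (hL0 : L.Nonempty) : volume K + volume L ≤ volume (K + L) := by
  obtain ⟨a, ha, hmax⟩ := hK.exists_isGreatest hK0
  obtain ⟨b, hb, hmin⟩ := hL.exists_isLeast hL0
  have hdisj : AEDisjoint volume ((· + b) '' K) ((a + ·) '' L) := by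
    refine measure_mono_null (t := {a + b}) ?_ (by simp)
    rintro _ ⟨⟨x, hx, rfl⟩, ⟨y, hy, hxy⟩⟩
    have h1 := hmax hx
    have h2 := hmin hy
    simp only at hxy
    simp only [Set.mem_singleton_iff]
    linarith
  have hmeas : MeasurableSet ((a + ·) '' L) := (hL.image (by fun_prop)).measurableSet
  calc volume K + volume L = volume ((· + b) '' K) + volume ((a + ·) '' L) := by simp
    _ = volume ((· + b) '' K ∪ (a + ·) '' L) :=
      (measure_union₀ hmeas.nullMeasurableSet hdisj).symm
    _ ≤ volume (K + L) := by
      refine measure_mono (Set.union_subset ?_ ?_)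
      · rintro _ ⟨x, hx, rfl⟩
        exact Set.add_mem_add hx hb
      · rintro _ ⟨y, hy, rfl⟩
        exact Set.add_mem_add ha hy

theorem MeasurableSet.volume_add_volume_le {A B : Set ℝ} (hA : MeasurableSet A)
    (hB : MeasurableSet B) (hA0 : A.Nonempty) (hB0 : B.Nonempty) :
    volume A + volume B ≤ volume (A + B) := by
  obtain ⟨a, ha⟩ := hA0
  obtain ⟨b, hb⟩ := hB0
  have key : ∀ K ⊆ A, IsCompact K → ∀ L ⊆ B, IsCompact L →
      volume K + volume L ≤ volume (A + B) := fun K hKA hK L hLB hL ↦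
    -- The approximating compact sets may be empty; adjoining a point of `A` and of `B` makes them
    -- nonempty.
    calc volume K + volume L ≤ volume (insert a K) + volume (insert b L) :=
          add_le_add (measure_mono (Set.subset_insert _ _)) (measure_mono (Set.subset_insert _ _))
      _ ≤ volume (insert a K + insert b L) :=
        (hK.insert a).volume_add_volume_le (hL.insert b) ⟨a, by simp⟩ ⟨b, by simp⟩
      _ ≤ volume (A + B) := measure_mono <|
        Set.add_subset_add (Set.insert_subset ha hKA) (Set.insert_subset hb hLB)
  rw [hA.measure_eq_iSup_isCompact, hB.measure_eq_iSup_isCompact]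
  simp_rw [iSup_and']
  refine ENNReal.biSup_add_biSup_le' ⟨∅, by simp⟩ ⟨∅, by simp⟩ fun K hK L hL ↦ ?_
  exact key K hK.1 hK.2 L hL.1 hL.2

/-- Layer cake: for `0 < t < 1`, `{f > t} + {g > t} ⊆ {k > t}`. The common maximum `1` makes both
summands nonempty for exactly these `t`, and both empty for `t ≥ 1`. -/
theorem integral_add_integral_le_of_min_le {f g k : ℝ → ℝ} (hf : Integrable f) (hg : Integrable g)
    (hk : Integrable k) (hfm : Measurable f) (hgm : Measurable g)
    (hf0 : 0 ≤ f) (hg0 : 0 ≤ g) (hk0 : 0 ≤ k)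
    (hf1 : IsGreatest (Set.range f) 1) (hg1 : IsGreatest (Set.range g) 1)
    (h : ∀ x y, 0 < f x → 0 < g y → min (f x) (g y) ≤ k (x + y)) :
    (∫ x, f x) + ∫ x, g x ≤ ∫ x, k x := by
  obtain ⟨⟨x₀, hx₀⟩, hf1⟩ := hf1
  obtain ⟨⟨y₀, hy₀⟩, hg1⟩ := hg1
  have hfa : Antitone fun t ↦ volume {x | t < f x} := fun s t hst ↦
    measure_mono fun x hx ↦ lt_of_le_of_lt hst hx
  have key : (∫⁻ x, ENNReal.ofReal (f x)) + ∫⁻ x, ENNReal.ofReal (g x) ≤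
      ∫⁻ x, ENNReal.ofReal (k x) := by
    rw [lintegral_eq_lintegral_meas_lt _ (.of_forall hf0) hf.aemeasurable,
      lintegral_eq_lintegral_meas_lt _ (.of_forall hg0) hg.aemeasurable,
      lintegral_eq_lintegral_meas_lt _ (.of_forall hk0) hk.aemeasurable,
      ← lintegral_add_left hfa.measurable]
    refine setLIntegral_mono_ae' measurableSet_Ioi (.of_forall fun t ht ↦ ?_)
    rw [Set.mem_Ioi] at ht
    by_cases ht1 : t < 1
    · refine (MeasurableSet.volume_add_volume_le (measurableSet_lt measurable_const hfm)
        (measurableSet_lt measurable_const hgm) ⟨x₀, by simpa [hx₀]⟩ ⟨y₀, by simpa [hy₀]⟩).trans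
        (measure_mono ?_)
      rintro _ ⟨x, hx, y, hy, rfl⟩
      exact (lt_min hx hy).trans_le (h x y (ht.trans hx) (ht.trans hy))
    · have hfe : {a | t < f a} = ∅ := Set.eq_empty_of_forall_notMem fun x hx ↦
        ht1 (lt_of_lt_of_le hx (hf1 ⟨x, rfl⟩))
      have hge : {a | t < g a} = ∅ := Set.eq_empty_of_forall_notMem fun x hx ↦
        ht1 (lt_of_lt_of_le hx (hg1 ⟨x, rfl⟩))
      simp [hfe, hge]
  rw [← ofReal_integral_eq_lintegral_ofReal hf (.of_forall hf0),
    ← ofReal_integral_eq_lintegral_ofReal hg (.of_forall hg0),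
    ← ofReal_integral_eq_lintegral_ofReal hk (.of_forall hk0),
    ← ENNReal.ofReal_add (integral_nonneg hf0) (integral_nonneg hg0)] at key
  exact (ENNReal.ofReal_le_ofReal_iff (integral_nonneg hk0)).1 key

/-! ### Linearising the norm condition -/

/-- Set `a = (x / z) ^ (1 / n)` and `b = (y / w) ^ (1 / n)`, so `a + b ≤ 1`. The tangent bound `s ^
(n + 1) / c ^ n ≥ (n + 1) * s - n * c` at `(t, a)` and `(1 - t, b)` sums to at least `n + 1 - n * (a
+ b) ≥ 1`. -/
theorem one_le_of_bmNorm_le_one {n : ℕ} {x y z w t : ℝ} (hx : 0 < x) (hy : 0 < y) (hxz : x ≤ z)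
    (hyw : y ≤ w) (ht0 : 0 ≤ t) (ht1 : t ≤ 1) (h : bmNorm n (x / z) (y / w) ≤ 1) :
    1 ≤ t ^ (n + 1) * (z / x) + (1 - t) ^ (n + 1) * (w / y) := by
  have hz := hx.trans_le hxz
  have hw := hy.trans_le hyw
  obtain rfl | hn := eq_or_ne n 0
  · have h1 : 1 ≤ z / x := (one_le_div hx).2 hxz
    have h2 : 1 ≤ w / y := (one_le_div hy).2 hyw
    nlinarith
  rw [bmNorm, if_neg hn, abs_of_pos (by positivity), abs_of_pos (by positivity)] at h
  set a := (x / z) ^ (1 / (n : ℝ)) with ha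
  set b := (y / w) ^ (1 / (n : ℝ)) with hb
  have ha0 : 0 < a := by positivity
  have hb0 : 0 < b := by positivity
  have hab : a + b ≤ 1 := by
    by_contra! hlt
    exact absurd h (not_le.2 (one_lt_pow₀ hlt hn))
  have han : z / x = (a ^ n)⁻¹ := by
    rw [ha, one_div, Real.rpow_inv_natCast_pow (by positivity) hn, inv_div]
  have hbn : w / y = (b ^ n)⁻¹ := by
    rw [hb, one_div, Real.rpow_inv_natCast_pow (by positivity) hn, inv_div]
  have bernoulli : ∀ {s c : ℝ}, 0 ≤ s → 0 < c →
      (n + 1) * s - n * c ≤ s ^ (n + 1) * (c ^ n)⁻¹ := by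
    intro s c hs hc
    have h1 := one_add_mul_le_pow (a := s / c - 1) (by have := div_nonneg hs hc.le; linarith)
      (n + 1)
    have h2 : s ^ (n + 1) * (c ^ n)⁻¹ = c * (1 + (s / c - 1)) ^ (n + 1) := by
      rw [add_sub_cancel, div_pow, pow_succ c]
      field_simp
    have h3 := mul_le_mul_of_nonneg_left h1 hc.le
    rw [h2]
    refine le_trans (le_of_eq ?_) h3
    push_cast
    field_simp
    ring
  rw [han, hbn]
  have h1 := bernoulli ht0 ha0
  have h2 := bernoulli (sub_nonneg.2 ht1) hb0
  have h3 : (n : ℝ) * (a + b) ≤ n := mul_le_of_le_one_right (by positivity) hab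
  linarith

theorem bmNorm_succ_le_one {n : ℕ} {p q : ℝ} (hp0 : 0 ≤ p) (hp1 : p ≤ 1) (hq0 : 0 ≤ q)
    (hq1 : q ≤ 1)
    (h : ∀ t : ℝ, 0 ≤ t → t ≤ 1 → p ≤ t ^ (n + 1) ∨ q ≤ (1 - t) ^ (n + 1)) :
    bmNorm (n + 1) p q ≤ 1 := by
  rw [bmNorm, if_neg n.succ_ne_zero, abs_of_nonneg hp0, abs_of_nonneg hq0]
  set a := p ^ (1 / ((n + 1 : ℕ) : ℝ)) with ha
  set b := q ^ (1 / ((n + 1 : ℕ) : ℝ)) with hb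
  have ha0 : 0 ≤ a := by positivity
  have hb0 : 0 ≤ b := by positivity
  have ha1 : a ≤ 1 := Real.rpow_le_one hp0 hp1 (by positivity)
  have hb1 : b ≤ 1 := Real.rpow_le_one hq0 hq1 (by positivity)
  have hap : a ^ (n + 1) = p := by
    rw [ha, one_div, Real.rpow_inv_natCast_pow hp0 n.succ_ne_zero]
  have hbq : b ^ (n + 1) = q := by
    rw [hb, one_div, Real.rpow_inv_natCast_pow hq0 n.succ_ne_zero]
  refine pow_le_one₀ (by positivity) ?_
  by_contra! hlt
  -- If `a + b > 1`, the midpoint `t` of `1 - b` and `a` has `t < a` and `1 - t < b`, so both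
  -- alternatives fail.
  obtain h1 | h1 := h ((1 - b + a) / 2) (by linarith) (by linarith)
  · rw [← hap] at h1
    have := (pow_le_pow_iff_left₀ ha0 (by linarith) n.succ_ne_zero).1 h1
    linarith
  · rw [← hbq] at h1
    have := (pow_le_pow_iff_left₀ hb0 (by linarith) n.succ_ne_zero).1 h1
    linarith

/-! ### The inequality on fibres over cosets of a normal subgroup -/

section Fibre

variable {G : Type*} [Group G] [TopologicalSpace G] [IsTopologicalGroup G]
  [MeasurableSpace G] [BorelSpace G]

theorem MeasureTheory.Measure.isRightHaarMeasure_inv (μ : Measure G) [μ.IsHaarMeasure]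
    [μ.Regular] : IsRightHaarMeasure μ.inv where

theorem IsRightHaarMeasure.isHaarMeasure_inv {ν : Measure G} (hν : IsRightHaarMeasure ν) :
    ν.inv.IsHaarMeasure where

theorem IsRightHaarMeasure.real_le_real_mul {ν : Measure G} (hν : IsRightHaarMeasure ν)
    {X Y : Set G} (hX : IsCompact X) (hY : IsCompact Y) (hY0 : Y.Nonempty) :
    ν.real X ≤ ν.real (X * Y) := by
  obtain ⟨y, hy⟩ := hY0
  have h : X ⊆ (· * y) ⁻¹' (X * Y) := fun x hx ↦ Set.mul_mem_mul hx hy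
  refine ENNReal.toReal_mono (hX.mul hY).measure_lt_top.ne ((measure_mono h).trans ?_)
  rw [measure_preimage_mul_right]

theorem MeasureTheory.Measure.real_le_real_mul (μ : Measure G) [μ.IsHaarMeasure]
    {X Y : Set G} (hX : IsCompact X) (hY : IsCompact Y) (hX0 : X.Nonempty) :
    μ.real Y ≤ μ.real (X * Y) := by
  obtain ⟨x, hx⟩ := hX0
  have h : Y ⊆ (x * ·) ⁻¹' (X * Y) := fun y hy ↦ Set.mul_mem_mul hx hy
  refine ENNReal.toReal_mono (hX.mul hY).measure_lt_top.ne ((measure_mono h).trans ?_)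
  rw [measure_preimage_mul]

theorem SatisfiesBM.one_le {n : ℕ} (h : SatisfiesBM G n) {μ ν : Measure G} [μ.IsHaarMeasure]
    [μ.Regular] (hν : IsRightHaarMeasure ν) {X Y : Set G} (hX : IsCompact X) (hY : IsCompact Y)
    (hX0 : 0 < ν.real X) (hY0 : 0 < μ.real Y) {t : ℝ} (ht0 : 0 ≤ t) (ht1 : t ≤ 1) :
    1 ≤ t ^ (n + 1) * (ν.real (X * Y) / ν.real X) +
      (1 - t) ^ (n + 1) * (μ.real (X * Y) / μ.real Y) := by
  have hXne : X.Nonempty := Set.nonempty_iff_ne_empty.2 fun h ↦ by simp [h] at hX0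
  have hYne : Y.Nonempty := Set.nonempty_iff_ne_empty.2 fun h ↦ by simp [h] at hY0
  exact one_le_of_bmNorm_le_one hX0 hY0 (hν.real_le_real_mul hX hY hYne)
    (μ.real_le_real_mul hX hY hXne) ht0 ht1 (h μ ν ‹_› ‹_› hν X Y hX hY)

/-- Measures of the fibres of `X`, `Y` and `X * Y` over the cosets of a normal subgroup. -/
theorem SatisfiesBM.one_le_fibre [T2Space G] {N : Subgroup G} [N.Normal]
    (hN : IsClosed (N : Set G)) {n : ℕ} (h : SatisfiesBM N n) (μ : Measure N) [μ.IsHaarMeasure]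
    [μ.Regular] {X Y Z : Set G} (hX : IsCompact X) (hY : IsCompact Y) (hZ : IsCompact Z)
    (hXYZ : X * Y ⊆ Z) (a b : G) (hX0 : 0 < μ.inv.real {s : N | s * a ∈ X})
    (hY0 : 0 < μ.real {s : N | b * s ∈ Y}) {t : ℝ} (ht0 : 0 ≤ t) (ht1 : t ≤ 1) :
    1 ≤ t ^ (n + 1) * (μ.inv.real {s : N | s * (a * b) ∈ Z} / μ.inv.real {s : N | s * a ∈ X}) +
      (1 - t) ^ (n + 1) * (μ.real {s : N | a * b * s ∈ Z} / μ.real {s : N | b * s ∈ Y}) := by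
  have hcl : Topology.IsClosedEmbedding (Subtype.val : N → G) := hN.isClosedEmbedding_subtypeVal
  have compR : ∀ {K : Set G}, IsCompact K → ∀ c : G, IsCompact {s : N | (s : G) * c ∈ K} :=
    fun hK c ↦ ((Homeomorph.mulRight c).isClosedEmbedding.comp hcl).isCompact_preimage hK
  have compL : ∀ {K : Set G}, IsCompact K → ∀ c : G, IsCompact {s : N | c * (s : G) ∈ K} :=
    fun hK c ↦ ((Homeomorph.mulLeft c).isClosedEmbedding.comp hcl).isCompact_preimage hK
  set c := a * b with hc
  set S : Set N := {s : N | (s : G) * a ∈ X}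
  set T : Set N := {s : N | b * (s : G) ∈ Y}
  -- As `(u * a) * (b * v) = c * (σ u * v)`, the set `σ S * T` sits in the left fibre of `Z` over
  -- `c`, and its preimage under `σ` in the right fibre. The right Haar measure `(μ.map σ).inv`
  -- absorbs the conjugation.
  let σ : N ≃* N := MulAut.conjNormal c⁻¹
  have hσ : ∀ s : N, (σ s : G) = c⁻¹ * s * c := fun s ↦ by simp [σ]
  have hσs : ∀ s : N, (σ.symm s : G) = c * s * c⁻¹ := fun s ↦ by
    have := hσ (σ.symm s)
    rw [σ.apply_symm_apply] at this
    rw [this]; group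
  have hσc : Continuous σ := by
    refine continuous_induced_rng.2 ?_
    simp only [Function.comp_def, hσ]
    fun_prop
  have hσc' : Continuous σ.symm := by
    refine continuous_induced_rng.2 ?_
    simp only [Function.comp_def, hσs]
    fun_prop
  let e : N ≃ₜ N := ⟨σ.toEquiv, hσc, hσc'⟩
  have : (μ.map e).Regular := Measure.Regular.map e
  have : (μ.map e).IsHaarMeasure := MulEquiv.isHaarMeasure_map μ σ hσc hσc'
  have hS : IsCompact S := compR hX a
  have hT : IsCompact T := compL hY b
  have hmap : ∀ A : Set N, (μ.map e).inv.real A = μ.inv.real (e ⁻¹' A) := by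
    intro A
    simp only [Measure.real, Measure.inv_apply]
    congr 1
    rw [← e.toMeasurableEquiv_coe, MeasurableEquiv.map_apply]
    congr 1
    ext s
    simp only [Set.mem_preimage, Set.mem_inv]
    exact iff_of_eq (congrArg (· ∈ A) (map_inv σ s).symm)
  have hpre : e ⁻¹' (e '' S) = S := e.injective.preimage_image S
  have key := h.one_le (μ := μ) (Measure.isRightHaarMeasure_inv (μ.map e)) (hS.image e.continuous)
    hT (by rwa [hmap, hpre]) hY0 ht0 ht1
  rw [hmap, hmap, hpre] at key
  have := Measure.isRightHaarMeasure_inv μ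
  have h1 : μ.inv.real (e ⁻¹' (e '' S * T)) ≤ μ.inv.real {s : N | (s : G) * c ∈ Z} := by
    refine measureReal_mono ?_ (compR hZ c).measure_lt_top.ne
    rintro s ⟨_, ⟨u, hu, rfl⟩, v, hv, huv⟩
    have huv' : c⁻¹ * (u : G) * c * v = c⁻¹ * s * c := by
      rw [← hσ, ← hσ]; exact congrArg Subtype.val huv
    have : (s : G) * c = (u * a) * (b * v) := by
      calc (s : G) * c = c * (c⁻¹ * s * c) := by group
        _ = (u * a) * (b * v) := by rw [← huv', hc]; group
    exact hXYZ (this ▸ Set.mul_mem_mul hu hv)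
  have h2 : μ.real (e '' S * T) ≤ μ.real {s : N | c * (s : G) ∈ Z} := by
    refine measureReal_mono ?_ (compL hZ c).measure_lt_top.ne
    rintro _ ⟨_, ⟨u, hu, rfl⟩, v, hv, rfl⟩
    have : c * ((e u * v : N) : G) = (u * a) * (b * v) := by
      have : (e u : G) = c⁻¹ * u * c := hσ u
      rw [Subgroup.coe_mul, this, hc]; group
    exact hXYZ (this ▸ Set.mul_mem_mul hu hv)
  have ht1' := sub_nonneg.2 ht1
  refine key.trans ?_
  gcongr

end Fibre

/-! ### Comparing integrals with measures of sets -/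

theorem MeasureTheory.integral_le_measureReal {α : Type*} [MeasurableSpace α] {μ : Measure α}
    {f : α → ℝ} {S : Set α} (hS : MeasurableSet S) (hμS : μ S ≠ ⊤) (hf : Integrable f μ)
    (hf1 : ∀ x ∈ S, f x ≤ 1) (hf0 : ∀ x ∉ S, f x ≤ 0) : ∫ x, f x ∂μ ≤ μ.real S := by
  rw [← integral_indicator_one hS]
  refine integral_mono hf ((integrable_indicator_iff hS).2 (integrableOn_const hμS)) fun x ↦ ?_
  by_cases hx : x ∈ S
  · simpa [hx] using hf1 x hx
  · simpa [hx] using hf0 x hx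

theorem MeasureTheory.measureReal_le_integral {α : Type*} [MeasurableSpace α] {μ : Measure α}
    {f : α → ℝ} {S : Set α} (hS : MeasurableSet S) (hμS : μ S ≠ ⊤) (hf : Integrable f μ)
    (hf1 : ∀ x ∈ S, 1 ≤ f x) (hf0 : ∀ x, 0 ≤ f x) : μ.real S ≤ ∫ x, f x ∂μ := by
  rw [← integral_indicator_one hS]
  refine integral_mono ((integrable_indicator_iff hS).2 (integrableOn_const hμS)) hf fun x ↦ ?_
  by_cases hx : x ∈ S
  · simpa [hx] using hf1 x hx
  · simpa [hx] using hf0 x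

theorem MeasureTheory.Measure.integral_inv {G : Type*} [MeasurableSpace G] [InvolutiveInv G]
    [MeasurableInv G] (μ : Measure G) (f : G → ℝ) : ∫ x, f x ∂μ.inv = ∫ x, f x⁻¹ ∂μ :=
  (MeasurableEquiv.inv G).measurableEmbedding.integral_map f

/-- The function `x ↦ f x⁻¹`. -/
noncomputable def CompactlySupportedContinuousMap.compInv {G : Type*} [Group G]
    [TopologicalSpace G] [IsTopologicalGroup G] (f : CompactlySupportedContinuousMap G ℝ) :
    CompactlySupportedContinuousMap G ℝ :=
  f.comp (Homeomorph.inv G).toCocompactMap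

theorem CompactlySupportedContinuousMap.compInv_apply {G : Type*} [Group G]
    [TopologicalSpace G] [IsTopologicalGroup G] (f : CompactlySupportedContinuousMap G ℝ) (x : G) :
    f.compInv x = f x⁻¹ := rfl

/-! ### Extensions of the real line -/

section RealQuotient

variable {C : Type*} [Group C] [TopologicalSpace C] {e : ℝ ≃ₜ C}

theorem Homeomorph.map_neg_of_map_add (he : ∀ x y, e (x + y) = e x * e y) (x : ℝ) :
    e (-x) = (e x)⁻¹ := by
  have h0 : e 0 = 1 := by simpa using he 0 0
  rw [eq_inv_iff_mul_eq_one, ← he, neg_add_cancel, h0]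

theorem Homeomorph.isHaarMeasure_map_volume [MeasurableSpace C] [BorelSpace C]
    [IsTopologicalGroup C] (he : ∀ x y, e (x + y) = e x * e y) :
    (volume.map e).IsHaarMeasure where
  lt_top_of_isCompact K hK := by
    rw [← e.toMeasurableEquiv_coe, MeasurableEquiv.map_apply]
    exact (e.isCompact_preimage.2 hK).measure_lt_top
  map_mul_left_eq_self c := by
    obtain ⟨x, rfl⟩ := e.surjective c
    rw [Measure.map_map (by fun_prop) e.continuous.measurable]
    have : (e x * ·) ∘ e = e ∘ (x + ·) := by ext y; simp [he]
    rw [this, ← Measure.map_map e.continuous.measurable (by fun_prop), map_add_left_eq_self]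
  open_pos U hU hne := by
    rw [← e.toMeasurableEquiv_coe, MeasurableEquiv.map_apply]
    exact (hU.preimage e.continuous).measure_ne_zero _ (hne.preimage e.surjective)

variable {G : Type*} [Group G] [TopologicalSpace G] [IsTopologicalGroup G]
  [LocallyCompactSpace G] [T2Space G] [MeasurableSpace G] [BorelSpace G] [IsTopologicalGroup C]
  {N : Subgroup G} {ψ : G →* C}

/-- Weil's formula: integrating over `N` and then over the quotient defines a Haar measure on `G`,
and Haar measure is unique up to scale. -/
theorem TopologicalGroup.IsSES.exists_integral_eq (H : TopologicalGroup.IsSES N.subtype ψ)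
    (he : ∀ x y, e (x + y) = e x * e y) (μN : Measure N) [μN.IsHaarMeasure]
    (μ : Measure G) [μ.IsHaarMeasure] :
    ∃ c : ℝ, 0 ≤ c ∧ ∀ f : CompactlySupportedContinuousMap G ℝ,
      ∫ x, f x ∂μ = c * ∫ x, H.pushforward μN f (e x) := by
  borelize C
  have := Homeomorph.isHaarMeasure_map_volume he
  let μ' := H.inducedMeasure μN (volume.map e)
  refine ⟨μ.haarScalarFactor μ', NNReal.coe_nonneg _, fun f ↦ ?_⟩
  refine (Measure.integral_isMulLeftInvariant_eq_smul_of_hasCompactSupport μ μ' f.continuous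
    f.hasCompactSupport).trans ?_
  change ∫ x, f x ∂_ = _
  rw [integral_smul_nnreal_measure, TopologicalGroup.IsSES.integral_inducedMeasure, TopologicalGroup.IsSES.integrate_apply,
    e.isClosedEmbedding.measurableEmbedding.integral_map]
  rfl

/-- Apply the left-handed formula to `ν.inv`. Keeping `(e x)⁻¹` makes the integrand at `x` a right
fibre integral over the coset above `e x` itself. -/
theorem TopologicalGroup.IsSES.exists_integral_eq_right (H : TopologicalGroup.IsSES N.subtype ψ)
    (he : ∀ x y, e (x + y) = e x * e y) (μN : Measure N) [μN.IsHaarMeasure]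
    {ν : Measure G} (hν : IsRightHaarMeasure ν) :
    ∃ c : ℝ, 0 ≤ c ∧ ∀ f : CompactlySupportedContinuousMap G ℝ,
      ∫ x, f x ∂ν = c * ∫ x, H.pushforward μN f.compInv (e x)⁻¹ := by
  have := hν.isHaarMeasure_inv
  obtain ⟨c, hc, h⟩ := H.exists_integral_eq he μN ν.inv
  refine ⟨c, hc, fun f ↦ ?_⟩
  simp_rw [← Homeomorph.map_neg_of_map_add he]
  rw [integral_neg_eq_self fun x ↦ H.pushforward μN f.compInv (e x), ← h f.compInv,
    Measure.integral_inv]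
  simp [CompactlySupportedContinuousMap.compInv_apply]

theorem SatisfiesBM.integral_pushforward_le [N.Normal] {n : ℕ} (h : SatisfiesBM N n)
    (H : TopologicalGroup.IsSES N.subtype ψ) (he : ∀ x y, e (x + y) = e x * e y)
    (μN : Measure N) [μN.IsHaarMeasure] [μN.Regular]
    {f g k : CompactlySupportedContinuousMap G ℝ} {X Y : Set G} (hX : IsCompact X)
    (hY : IsCompact Y) (hf : ∀ x, f x ∈ Set.Icc 0 1) (hg : ∀ x, g x ∈ Set.Icc 0 1)
    (hk : ∀ x, 0 ≤ k x) (hfX : ∀ x ∉ X, f x = 0) (hgY : ∀ x ∉ Y, g x = 0)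
    (hkXY : ∀ x ∈ X * Y, k x = 1) {t : ℝ} (ht0 : 0 ≤ t) (ht1 : t ≤ 1) :
    ∫ x, H.pushforward μN f.compInv (e x)⁻¹ ≤
        t ^ (n + 1) * ∫ x, H.pushforward μN k.compInv (e x)⁻¹ ∨
      ∫ x, H.pushforward μN g (e x) ≤ (1 - t) ^ (n + 1) * ∫ x, H.pushforward μN k (e x) := by
  have hN : IsClosed (N : Set G) := by simpa using H.isClosedEmbedding.isClosed_range
  have hcl : Topology.IsClosedEmbedding (Subtype.val : N → G) := hN.isClosedEmbedding_subtypeVal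
  have compR : ∀ {K : Set G}, IsCompact K → ∀ c : G, IsCompact {s : N | (s : G) * c ∈ K} :=
    fun hK c ↦ ((Homeomorph.mulRight c).isClosedEmbedding.comp hcl).isCompact_preimage hK
  have compL : ∀ {K : Set G}, IsCompact K → ∀ c : G, IsCompact {s : N | c * (s : G) ∈ K} :=
    fun hK c ↦ ((Homeomorph.mulLeft c).isClosedEmbedding.comp hcl).isCompact_preimage hK
  have hXY := hX.mul hY
  have applyL : ∀ (φ : CompactlySupportedContinuousMap G ℝ) (b : G),
      H.pushforward μN φ (ψ b) = ∫ s : N, φ (b * s) ∂μN := fun φ b ↦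
    H.pushforward_apply_apply μN φ b
  have intL : ∀ (φ : CompactlySupportedContinuousMap G ℝ) (b : G),
      Integrable (fun s : N ↦ φ (b * s)) μN := fun φ b ↦ (H.pullback φ b).integrable
  have applyR : ∀ (φ : CompactlySupportedContinuousMap G ℝ) (a : G),
      H.pushforward μN φ.compInv (ψ a)⁻¹ = ∫ s : N, φ (s * a) ∂μN.inv := by
    intro φ a
    rw [← map_inv, applyL, Measure.integral_inv]
    simp [CompactlySupportedContinuousMap.compInv_apply]
  have hRinv := Measure.isRightHaarMeasure_inv μN
  have intR : ∀ (φ : CompactlySupportedContinuousMap G ℝ) (a : G),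
      Integrable (fun s : N ↦ φ (s * a)) μN.inv := by
    intro φ a
    refine Continuous.integrable_of_hasCompactSupport (by fun_prop) ?_
    exact φ.hasCompactSupport.comp_isClosedEmbedding
      ((Homeomorph.mulRight a).isClosedEmbedding.comp hcl)
  set F : ℝ → ℝ := fun x ↦ H.pushforward μN f.compInv (e x)⁻¹ with hF
  set Q : ℝ → ℝ := fun x ↦ H.pushforward μN g (e x) with hQ
  set KR : ℝ → ℝ := fun x ↦ H.pushforward μN k.compInv (e x)⁻¹ with hKR
  set KL : ℝ → ℝ := fun x ↦ H.pushforward μN k (e x) with hKL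
  have contL : ∀ φ : CompactlySupportedContinuousMap G ℝ,
      Continuous fun x ↦ H.pushforward μN φ (e x) := fun φ ↦ by fun_prop
  have contR : ∀ φ : CompactlySupportedContinuousMap G ℝ,
      Continuous fun x ↦ H.pushforward μN φ (e x)⁻¹ := fun φ ↦ by fun_prop
  have suppL : ∀ φ : CompactlySupportedContinuousMap G ℝ,
      HasCompactSupport fun x ↦ H.pushforward μN φ (e x) := fun φ ↦
    (H.pushforward μN φ).hasCompactSupport.comp_homeomorph e
  have suppR : ∀ φ : CompactlySupportedContinuousMap G ℝ,
      HasCompactSupport fun x ↦ H.pushforward μN φ (e x)⁻¹ := fun φ ↦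
    (H.pushforward μN φ).hasCompactSupport.comp_homeomorph (e.trans (Homeomorph.inv C))
  have lift : ∀ x, ∃ a, ψ a = e x := fun x ↦ H.isOpenQuotientMap.surjective (e x)
  have hF0 : 0 ≤ F := fun x ↦ by
    obtain ⟨a, ha⟩ := lift x
    simp only [hF, ← ha, applyR]
    exact integral_nonneg fun s ↦ (hf _).1
  have hQ0 : 0 ≤ Q := fun x ↦ by
    obtain ⟨a, ha⟩ := lift x
    simp only [hQ, ← ha, applyL]
    exact integral_nonneg fun s ↦ (hg _).1
  have hKR0 : 0 ≤ KR := fun x ↦ by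
    obtain ⟨a, ha⟩ := lift x
    simp only [hKR, ← ha, applyR]
    exact integral_nonneg fun s ↦ hk _
  have hKL0 : 0 ≤ KL := fun x ↦ by
    obtain ⟨a, ha⟩ := lift x
    simp only [hKL, ← ha, applyL]
    exact integral_nonneg fun s ↦ hk _
  have ht1' := sub_nonneg.2 ht1
  obtain ⟨x₀, hx₀⟩ := (contR f.compInv).exists_forall_ge_of_hasCompactSupport (suppR f.compInv)
  obtain ⟨y₀, hy₀⟩ := (contL g).exists_forall_ge_of_hasCompactSupport (suppL g)
  change ∀ x, F x ≤ F x₀ at hx₀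
  change ∀ y, Q y ≤ Q y₀ at hy₀
  obtain hα | hα := (hF0 x₀).eq_or_lt
  · left
    calc ∫ x, F x ≤ 0 := integral_nonpos fun x ↦ (hx₀ x).trans hα.ge
      _ ≤ _ := mul_nonneg (by positivity) (integral_nonneg hKR0)
  obtain hβ | hβ := (hQ0 y₀).eq_or_lt
  · right
    calc ∫ x, Q x ≤ 0 := integral_nonpos fun x ↦ (hy₀ x).trans hβ.ge
      _ ≤ _ := mul_nonneg (by positivity) (integral_nonneg hKL0)
  simp only [Pi.zero_apply] at hα hβ
  set α := F x₀
  set β := Q y₀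
  have main : ∀ x y, 0 < F x / α → 0 < Q y / β → min (F x / α) (Q y / β) ≤
      t ^ (n + 1) / α * KR (x + y) + (1 - t) ^ (n + 1) / β * KL (x + y) := by
    intro x y hx hy
    obtain ⟨a, ha⟩ := lift x
    obtain ⟨b, hb⟩ := lift y
    have hab : ψ (a * b) = e (x + y) := by rw [map_mul, ha, hb, he]
    have hFx : F x ≤ μN.inv.real {s : N | s * a ∈ X} := by
      simp only [hF, ← ha, applyR]
      exact integral_le_measureReal (compR hX a).measurableSet (compR hX a).measure_lt_top.ne
        (intR f a) (fun s _ ↦ (hf _).2) fun s hs ↦ (hfX _ hs).le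
    have hQy : Q y ≤ μN.real {s : N | b * s ∈ Y} := by
      simp only [hQ, ← hb, applyL]
      exact integral_le_measureReal (compL hY b).measurableSet (compL hY b).measure_lt_top.ne
        (intL g b) (fun s _ ↦ (hg _).2) fun s hs ↦ (hgY _ hs).le
    have hKRxy : μN.inv.real {s : N | s * (a * b) ∈ X * Y} ≤ KR (x + y) := by
      simp only [hKR, ← hab, applyR]
      exact measureReal_le_integral (compR hXY _).measurableSet
        (compR hXY _).measure_lt_top.ne (intR k _) (fun s hs ↦ (hkXY _ hs).ge) fun s ↦ hk _
    have hKLxy : μN.real {s : N | a * b * s ∈ X * Y} ≤ KL (x + y) := by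
      simp only [hKL, ← hab, applyL]
      exact measureReal_le_integral (compL hXY _).measurableSet
        (compL hXY _).measure_lt_top.ne (intL k _) (fun s hs ↦ (hkXY _ hs).ge) fun s ↦ hk _
    -- The fibres of `X` and `Y` have measures at least `τ * α` and `τ * β`; putting these in the
    -- denominators and multiplying by `τ` gives the claim.
    set τ := min (F x / α) (Q y / β)
    have hτ : 0 < τ := lt_min hx hy
    have hτα : τ * α ≤ μN.inv.real {s : N | s * a ∈ X} :=
      ((le_div_iff₀ hα).1 (min_le_left _ _)).trans hFx
    have hτβ : τ * β ≤ μN.real {s : N | b * s ∈ Y} :=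
      ((le_div_iff₀ hβ).1 (min_le_right _ _)).trans hQy
    have key := h.one_le_fibre hN μN hX hY hXY subset_rfl a b
      ((mul_pos hτ hα).trans_le hτα) ((mul_pos hτ hβ).trans_le hτβ) ht0 ht1
    have hKRp := hKR0 (x + y)
    have hKLp := hKL0 (x + y)
    simp only [Pi.zero_apply] at hKRp hKLp
    have key2 : 1 ≤ t ^ (n + 1) * (KR (x + y) / (τ * α)) +
        (1 - t) ^ (n + 1) * (KL (x + y) / (τ * β)) := by
      refine key.trans ?_
      gcongr
    calc τ = τ * 1 := (mul_one τ).symm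
      _ ≤ τ * _ := mul_le_mul_of_nonneg_left key2 hτ.le
      _ = _ := by field_simp
  have iF : Integrable F := (contR _).integrable_of_hasCompactSupport (suppR _)
  have iQ : Integrable Q := (contL _).integrable_of_hasCompactSupport (suppL _)
  have iKR : Integrable KR := (contR _).integrable_of_hasCompactSupport (suppR _)
  have iKL : Integrable KL := (contL _).integrable_of_hasCompactSupport (suppL _)
  have key := integral_add_integral_le_of_min_le (iF.div_const α) (iQ.div_const β)
    ((iKR.const_mul (t ^ (n + 1) / α)).add (iKL.const_mul ((1 - t) ^ (n + 1) / β)))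
    ((contR _).measurable.div_const α) ((contL _).measurable.div_const β)
    (fun x ↦ div_nonneg (hF0 x) hα.le) (fun x ↦ div_nonneg (hQ0 x) hβ.le)
    (fun x ↦ add_nonneg (mul_nonneg (by positivity) (hKR0 x))
      (mul_nonneg (by positivity) (hKL0 x)))
    ⟨⟨x₀, div_self hα.ne'⟩, Set.forall_mem_range.2 fun x ↦ (div_le_one hα).2 (hx₀ x)⟩
    ⟨⟨y₀, div_self hβ.ne'⟩, Set.forall_mem_range.2 fun x ↦ (div_le_one hβ).2 (hy₀ x)⟩ main
  simp only [Pi.add_apply] at key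
  rw [integral_add (iKR.const_mul _) (iKL.const_mul _), integral_const_mul, integral_const_mul,
    integral_div, integral_div] at key
  by_contra! hlt
  have h1 := div_lt_div_of_pos_right hlt.1 hα
  have h2 := div_lt_div_of_pos_right hlt.2 hβ
  rw [mul_div_right_comm] at h1 h2
  linarith

theorem SatisfiesBM.succ_of_isSES [N.Normal] {n : ℕ} (h : SatisfiesBM N n)
    (H : TopologicalGroup.IsSES N.subtype ψ) (he : ∀ x y, e (x + y) = e x * e y) :
    SatisfiesBM G (n + 1) := by
  intro μ ν hμ hμr hν X Y hX hY
  -- For empty `X`, `μ Y` may be positive while `μ (X * Y) = 0`; division by zero returns `0`.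
  obtain rfl | hX0 := X.eq_empty_or_nonempty
  · simpa using bmNorm_succ_le_one (n := n) le_rfl zero_le_one le_rfl zero_le_one
      fun t ht _ ↦ .inl (pow_nonneg ht _)
  obtain rfl | hY0 := Y.eq_empty_or_nonempty
  · simpa using bmNorm_succ_le_one (n := n) le_rfl zero_le_one le_rfl zero_le_one
      fun t ht _ ↦ .inl (pow_nonneg ht _)
  have hN : IsClosed (N : Set G) := by simpa using H.isClosedEmbedding.isClosed_range
  have : LocallyCompactSpace N := hN.isClosedEmbedding_subtypeVal.locallyCompactSpace
  obtain ⟨c₁, hc₁, hν'⟩ := H.exists_integral_eq_right he Measure.haar hν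
  obtain ⟨c₂, hc₂, hμ'⟩ := H.exists_integral_eq he Measure.haar μ
  have hXY := hX.mul hY
  have outer : ∀ (ρ : Measure G) [ρ.OuterRegular] [IsFiniteMeasureOnCompacts ρ] {r w : ℝ},
      0 ≤ r → r ≤ 1 → r * ρ.real (X * Y) < w →
      ∃ U ⊇ X * Y, IsOpen U ∧ ρ U ≠ ⊤ ∧ r * ρ.real U < w := by
    intro ρ _ _ r w hr0 hr1 hw
    set δ := w - r * ρ.real (X * Y)
    have hδ : 0 < δ := sub_pos.2 hw
    obtain ⟨U, hUs, hUo, hU⟩ := Set.exists_isOpen_lt_of_lt (μ := ρ) (X * Y)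
      (ENNReal.ofReal (ρ.real (X * Y) + δ / 2)) (by
        rw [ENNReal.lt_ofReal_iff_toReal_lt hXY.measure_lt_top.ne]
        exact lt_add_of_pos_right _ (half_pos hδ))
    refine ⟨U, hUs, hUo, hU.ne_top, ?_⟩
    have hU' : ρ.real U < ρ.real (X * Y) + δ / 2 :=
      (ENNReal.lt_ofReal_iff_toReal_lt hU.ne_top).1 hU
    calc r * ρ.real U ≤ r * (ρ.real (X * Y) + δ / 2) := by gcongr
      _ = r * ρ.real (X * Y) + r * (δ / 2) := by ring
      _ ≤ r * ρ.real (X * Y) + δ / 2 := by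
        gcongr
        exact mul_le_of_le_one_left (half_pos hδ).le hr1
      _ < w := by simp only [δ] at hδ ⊢; linarith
  refine bmNorm_succ_le_one (by positivity)
    (div_le_one_of_le₀ (hν.real_le_real_mul hX hY hY0) measureReal_nonneg) (by positivity)
    (div_le_one_of_le₀ (μ.real_le_real_mul hX hY hX0) measureReal_nonneg) fun t ht0 ht1 ↦ ?_
  suffices ν.real X ≤ t ^ (n + 1) * ν.real (X * Y) ∨
      μ.real Y ≤ (1 - t) ^ (n + 1) * μ.real (X * Y) from
    this.imp (fun h ↦ div_le_of_le_mul₀ measureReal_nonneg (by positivity) h)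
      (fun h ↦ div_le_of_le_mul₀ measureReal_nonneg (pow_nonneg (sub_nonneg.2 ht1) _) h)
  by_contra! hlt
  obtain ⟨U₁, hU₁, ho₁, hfin₁, hlt₁⟩ := outer ν (by positivity) (pow_le_one₀ ht0 ht1) hlt.1
  obtain ⟨U₂, hU₂, ho₂, hfin₂, hlt₂⟩ := outer μ (pow_nonneg (sub_nonneg.2 ht1) _)
    (pow_le_one₀ (sub_nonneg.2 ht1) (by linarith)) hlt.2
  -- Supports inside `u` and `v` keep the product of the supports of `f` and `g` within `U₁ ∩ U₂`,
  -- leaving room for `k`.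
  obtain ⟨u, v, hu, hv, hXu, hYv, huv⟩ := generalized_tube_lemma hX hY
    (n := (fun p : G × G ↦ p.1 * p.2) ⁻¹' (U₁ ∩ U₂)) ((ho₁.inter ho₂).preimage continuous_mul)
    (fun p hp ↦ ⟨hU₁ (Set.mul_mem_mul hp.1 hp.2), hU₂ (Set.mul_mem_mul hp.1 hp.2)⟩)
  obtain ⟨f, hf1, hfc, hfu, hf⟩ := exists_continuousMap_one_of_isCompact_subset_isOpen hX hu hXu
  obtain ⟨g, hg1, hgc, hgv, hg⟩ := exists_continuousMap_one_of_isCompact_subset_isOpen hY hv hYv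
  obtain ⟨k, hk1, hkc, hkU, hk⟩ := exists_continuousMap_one_of_isCompact_subset_isOpen
    (hfc.mul hgc) (ho₁.inter ho₂) (by
      rintro _ ⟨x, hx, y, hy, rfl⟩
      exact huv (show (x, y) ∈ u ×ˢ v from ⟨hfu hx, hgv hy⟩))
  have key := h.integral_pushforward_le H he Measure.haar (f := ⟨f, hfc⟩) (g := ⟨g, hgc⟩)
    (k := ⟨k, hkc⟩) hfc hgc hf hg (fun x ↦ (hk x).1) (fun x hx ↦ image_eq_zero_of_notMem_tsupport hx)
    (fun x hx ↦ image_eq_zero_of_notMem_tsupport hx) (fun x hx ↦ hk1 hx) ht0 ht1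
  have hk0 : ∀ {U : Set G}, U₁ ∩ U₂ ⊆ U → ∀ x ∉ U, k x ≤ 0 := fun hU x hx ↦
    (image_eq_zero_of_notMem_tsupport fun hx' ↦ hx (hU (hkU hx'))).le
  obtain hle | hle := key
  · have h1 : ν.real X ≤ ∫ x, f x ∂ν := measureReal_le_integral hX.measurableSet
      hX.measure_lt_top.ne (f.continuous.integrable_of_hasCompactSupport hfc)
      (fun x hx ↦ (hf1 hx).ge) fun x ↦ (hf x).1
    have h2 : ∫ x, k x ∂ν ≤ ν.real U₁ := integral_le_measureReal ho₁.measurableSet hfin₁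
      (k.continuous.integrable_of_hasCompactSupport hkc) (fun x _ ↦ (hk x).2)
      (hk0 Set.inter_subset_left)
    have h3 : ∫ x, f x ∂ν ≤ t ^ (n + 1) * ∫ x, k x ∂ν := by
      have h4 := mul_le_mul_of_nonneg_left hle hc₁
      rwa [mul_left_comm, ← hν', ← hν'] at h4
    have h4 := mul_le_mul_of_nonneg_left h2 (pow_nonneg ht0 (n + 1))
    linarith
  · have h1 : μ.real Y ≤ ∫ x, g x ∂μ := measureReal_le_integral hY.measurableSet
      hY.measure_lt_top.ne (g.continuous.integrable_of_hasCompactSupport hgc)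
      (fun x hx ↦ (hg1 hx).ge) fun x ↦ (hg x).1
    have h2 : ∫ x, k x ∂μ ≤ μ.real U₂ := integral_le_measureReal ho₂.measurableSet hfin₂
      (k.continuous.integrable_of_hasCompactSupport hkc) (fun x _ ↦ (hk x).2)
      (hk0 Set.inter_subset_right)
    have h3 : ∫ x, g x ∂μ ≤ (1 - t) ^ (n + 1) * ∫ x, k x ∂μ := by
      have h4 := mul_le_mul_of_nonneg_left hle hc₂
      rwa [mul_left_comm, ← hμ', ← hμ'] at h4
    have h4 := mul_le_mul_of_nonneg_left h2 (pow_nonneg (sub_nonneg.2 ht1) (n + 1))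
    linarith

end RealQuotient

theorem mainTheorem6 {G : Type*} [Group G] [TopologicalSpace G] [IsTopologicalGroup G]
    [LocallyCompactSpace G] [T2Space G] [MeasurableSpace G] [BorelSpace G] (n : ℕ)
    (hquot : Topology.IsQuotientMap (modularFunction G))
    (hker : SatisfiesBM (modularFunction G).ker n) :
    SatisfiesBM G (n + 1) := by
  have : IsTopologicalGroup {r : ℝ // 0 < r} :=
    { continuous_mul := by
        refine continuous_induced_rng.2 ?_
        exact (continuous_subtype_val.comp continuous_fst).mul
          (continuous_subtype_val.comp continuous_snd)
      continuous_inv := by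
        refine continuous_induced_rng.2 ?_
        exact continuous_subtype_val.inv₀ fun x ↦ x.2.ne' }
  have hcl : IsClosed ((modularFunction G).ker : Set G) :=
    isClosed_singleton.preimage hquot.continuous
  have H : TopologicalGroup.IsSES (modularFunction G).ker.subtype (modularFunction G) :=
    { isClosedEmbedding := hcl.isClosedEmbedding_subtypeVal
      isOpenQuotientMap := MonoidHom.isOpenQuotientMap_of_isQuotientMap hquot
      mulExact := fun x ↦ by simp [MonoidHom.mem_ker] }
  let e : ℝ ≃ₜ {r : ℝ // 0 < r} := Real.expOrderIso.toHomeomorph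
  exact hker.succ_of_isSES H (e := e) fun x y ↦ Subtype.ext (Real.exp_add x y)
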